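/- **Theorem 4.1.** Let $X$ be a real Hilbert space, let $m\geq 3$, let $A_1,\dots,A_m$ be maximally monotone set-valued operators on $X$, put $I=\{1,\dots,m\}$, and let $\lambda_i=\tfrac1m$ and $\mu_i=1-\lambda_i$ for every $i\in I$. For a set-valued operator $B$ on $X$ write $J_B=(\mathrm{Id}+B)^{-1}$ for its resolvent; when $B$ is maximally monotone, $J_B$ is a single-valued map $X\to X$. Let $$A=\Big(\sum_{i\in I}\lambda_iJ_{A_i}\Big)^{-1}-\mathrm{Id}$$ be the resolvent average of $A_1,\dots,A_m$, so that $J_A=\sum_{i\in I}\lambda_iJ_{A_i}$, and let $\operatorname{Fix}J_A=\{x\in X: x=J_Ax\}$. Let $\mathbf X=X^m$ be the Hilbert product space with inner product $\langle \mathbf x,\mathbf y\rangle=\sum_{i\in I}\langle x_i,y_i\rangle$, and define $\mathbf R,\mathbf J\colon\mathbf X\to\mathbf X$ and $\mathbf S\subseteq\mathbf X$ by $$\mathbf R\mathbf x=\Big(\sum_{j\in I\setminus\{i\}}\frac{\lambda_j}{\mu_i}x_j\Big)_{i\in I},\qquad \mathbf J\mathbf x=\big(J_{\mu_i^{-1}A_i}x_i\big)_{i\in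 I},$$ $$\mathbf S=\Big\{\mathbf x=(x_i)_{i\in I}\in\mathbf X:\ x_i=J_{\mu_i^{-1}A_i}\Big(\sum_{j\in I\setminus\{i\}}\frac{\lambda_j}{\mu_i}x_j\Big)\text{ for every } i\in I\Big\}.$$ Let $\mathbf x_0\in\mathbf X$ and let $\mathbf x_{n+1}=(\mathbf J\circ\mathbf R)\mathbf x_n$ for every $n\in\mathbb N$, where $\mathbf x_n=(x_{n,i})_{i\in I}$. Then exactly one of the following holds. 1. $\operatorname{Fix}J_A\neq\varnothing$, $(\mathbf x_n)_{n\in\mathbb N}$ converges weakly to a point $\mathbf x=(x_i)_{i\in I}$ in $\mathbf S$, and $\big(\sum_{i\in I}\lambda_ix_{n,i}\big)_{n\in\mathbb N}$ converges weakly to $\sum_{i\in I}\lambda_ix_i\in\operatorname{Fix}J_A$. 2. $\operatorname{Fix}J_A=\varnothing$ and $\|\mathbf x_n\|\to+\infty$. -/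

import Mathlib

open Filter Topology
open scoped Pointwise

noncomputable section

namespace ResolventAverage

variable {X : Type*} [NormedAddCommGroup X] [InnerProductSpace ℝ X]

/-- A set-valued operator `A : X ⇉ X` (a map `X → Set X`) is monotone if
`⟪x - y, u - v⟫ ≥ 0` for all `(x, u)` and `(y, v)` in its graph. -/
def IsMonotone (A : X → Set X) : Prop :=
  ∀ x u y v, u ∈ A x → v ∈ A y → 0 ≤ inner ℝ (x - y) (u - v)

/-- Maximal monotonicity: `A` is monotone and no proper extension of `A` is monotone. -/
def IsMaximallyMonotone (A : X → Set X) : Prop :=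
  IsMonotone A ∧ ∀ B : X → Set X, (∀ x, A x ⊆ B x) → A ≠ B → ¬ IsMonotone B

/-- The inverse of a set-valued operator: `x ∈ A⁻¹ u` if and only if `u ∈ A x`. -/
def inverse (A : X → Set X) : X → Set X :=
  fun u => {x | u ∈ A x}

/-- The resolvent `(Id + A)⁻¹` as a set-valued operator. -/
def setResolvent (A : X → Set X) : X → Set X :=
  inverse fun x => {x} + A x

/-- `p ∈ (Id + A)⁻¹ x` if and only if `x - p ∈ A p`. -/
theorem mem_setResolvent {A : X → Set X} {x p : X} :
    p ∈ setResolvent A x ↔ x - p ∈ A p := by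
  simp [setResolvent, inverse, sub_eq_neg_add]

/-- The resolvent of a monotone operator is at most single-valued. -/
theorem setResolvent_subsingleton {A : X → Set X} (hA : IsMonotone A) (x : X) :
    (setResolvent A x).Subsingleton := by
  intro p hp q hq
  have h := hA p _ q _ (mem_setResolvent.1 hp) (mem_setResolvent.1 hq)
  have e : x - p - (x - q) = -(p - q) := by abel
  rw [e, inner_neg_right, real_inner_self_eq_norm_sq] at h
  have h0 : ‖p - q‖ ^ 2 = 0 := le_antisymm (by linarith) (sq_nonneg _)
  exact sub_eq_zero.1 (norm_eq_zero.1 (pow_eq_zero_iff two_ne_zero |>.1 h0))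

open Classical in
/-- The resolvent `J_A = (Id + A)⁻¹` as a map `X → X`: the point of `(Id + A)⁻¹ x`.
For a maximally monotone operator on a real Hilbert space the set `(Id + A)⁻¹ x` is always
a singleton; the default value `0` is used only where that set is empty. -/
def resolventMap (A : X → Set X) : X → X :=
  fun x => if h : (setResolvent A x).Nonempty then h.some else 0

variable {m : ℕ}

/-- The resolvent average `A = (∑ i, λ i J_{A i})⁻¹ - Id` of `A 1, …, A m` with weights `λ`. -/
def resolventAverage (lam : Fin m → ℝ) (A : Fin m → X → Set X) : X → Set X :=
  fun x => inverse (fun y => {∑ i, lam i • resolventMap (A i) y}) x - {x}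

/-- The Hilbert product space `X ^ m`, with `⟪x, y⟫ = ∑ i, ⟪x i, y i⟫`. -/
abbrev ProductSpace (X : Type*) (m : ℕ) : Type _ := PiLp 2 fun _ : Fin m => X

/-- The resolvent of the operator `μ i⁻¹ A i`, where `μ i = 1 - λ i`. -/
def scaledResolvent (lam : Fin m → ℝ) (A : Fin m → X → Set X) (i : Fin m) : X → X :=
  resolventMap fun x => (1 - lam i)⁻¹ • A i x

/-- The linear map `R x = (∑ j ≠ i, (λ j / μ i) x j)_i` on `X ^ m`, where `μ i = 1 - λ i`. -/
def opR (lam : Fin m → ℝ) : ProductSpace X m → ProductSpace X m :=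
  fun x => WithLp.toLp 2 fun i => ∑ j ∈ Finset.univ.erase i, (lam j / (1 - lam i)) • x j

/-- The map `J x = (J_{μ i⁻¹ A i} (x i))_i` on `X ^ m`, where `μ i = 1 - λ i`. -/
def opJ (lam : Fin m → ℝ) (A : Fin m → X → Set X) : ProductSpace X m → ProductSpace X m :=
  fun x => WithLp.toLp 2 fun i => scaledResolvent lam A i (x i)

/-- The set `S` of all `x ∈ X ^ m` such that, for every `i`,
`x i = J_{μ i⁻¹ A i} (∑ j ≠ i, (λ j / μ i) x j)`, where `μ i = 1 - λ i`. -/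
def setS (lam : Fin m → ℝ) (A : Fin m → X → Set X) : Set (ProductSpace X m) :=
  {x | ∀ i, x i =
    scaledResolvent lam A i (∑ j ∈ Finset.univ.erase i, (lam j / (1 - lam i)) • x j)}

/-- Weak convergence of a sequence: convergence in the weak topology. -/
def WeaklyConvergesTo {E : Type*} [NormedAddCommGroup E] [InnerProductSpace ℝ E]
    (x : ℕ → E) (l : E) : Prop :=
  Tendsto (fun n => toWeakSpace ℝ E (x n)) atTop (𝓝 (toWeakSpace ℝ E l))

end ResolventAverage

end

/-! Scaling the inclusion that defines `setS` by `1 - lam i` turns it into `x i = J_{A i} s`, where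
`s` is the weighted mean of the components (`mem_setS_iff`). Thus points of `setS`, the fixed points
of `opJ ∘ opR`, correspond to fixed points of the averaged resolvent. The map `opR` is averaged
because `m ≥ 3`, and `opJ` is firmly nonexpansive, so the composite is averaged
(`isAveragedWith_opJ_comp_opR`).

For an averaged map the displacements along an orbit decrease in norm to some `d`, and `k * d ≤ ‖x 0
- x k‖`. If `d > 0`, the orbit diverges. If `d = 0`, demiclosedness makes every weak cluster point
fixed. Without fixed points the norms must then tend to infinity; with one, Opial's argument gives
weak convergence. Everywhere-defined resolvents come from Minty's theorem, proved through the
Fitzpatrick function. -/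

namespace ResolventAverage

/-! ### Averaged and nonexpansive maps -/

section Nonexpansive

variable {E : Type*} [NormedAddCommGroup E]

/-- The strengthened nonexpansiveness inequality with constant `c`; for `c > 0` it says that `T` is
an averaged map. -/
def IsAveragedWith (c : ℝ) (T : E → E) : Prop :=
  ∀ x y, ‖T x - T y‖ ^ 2 + c * ‖(x - T x) - (y - T y)‖ ^ 2 ≤ ‖x - y‖ ^ 2

variable {c : ℝ} {T : E → E} {x : ℕ → E}

theorem IsAveragedWith.norm_sub_le (hT : IsAveragedWith c T) (hc : 0 < c) (x y : E) :
    ‖T x - T y‖ ≤ ‖x - y‖ := by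
  have h := hT x y
  refine le_of_sq_le_sq ?_ (norm_nonneg _)
  nlinarith [mul_nonneg hc.le (sq_nonneg ‖(x - T x) - (y - T y)‖)]

theorem antitone_norm_sub (hT : ∀ x y, ‖T x - T y‖ ≤ ‖x - y‖) (hx : ∀ n, x (n + 1) = T (x n))
    (k : ℕ) : Antitone fun n => ‖x n - x (n + k)‖ := by
  refine antitone_nat_of_succ_le fun n => ?_
  rw [show n + 1 + k = n + k + 1 by ring, hx, hx]
  exact hT _ _

end Nonexpansive

/-! ### Weak limits and orbits of averaged maps -/

section Averaged

variable {E : Type*} [NormedAddCommGroup E] [InnerProductSpace ℝ E]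

/-- The weak topology is induced by evaluation at functionals, which are inner products by Riesz. -/
theorem weaklyConvergesTo_of_inner [CompleteSpace E] {x : ℕ → E} {l : E}
    (h : ∀ y, Tendsto (fun n => inner ℝ y (x n)) atTop (𝓝 (inner ℝ y l))) :
    WeaklyConvergesTo x l := by
  unfold WeaklyConvergesTo
  have hind : IsInducing fun (a : WeakSpace ℝ E) (f : StrongDual ℝ E) =>
      (topDualPairing ℝ E).flip a f := ⟨rfl⟩
  rw [hind.tendsto_nhds_iff, tendsto_pi_nhds]
  intro f
  have := h ((InnerProductSpace.toDual ℝ E).symm f)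
  simp only [InnerProductSpace.toDual_symm_apply] at this
  exact this

/-- A sequence bounded along an ultrafilter has a weak limit along it. -/
theorem exists_weak_limit [CompleteSpace E] {ι : Type*} (U : Ultrafilter ι) {x : ι → E} {C : ℝ}
    (hx : ∀ᶠ n in U, ‖x n‖ ≤ C) :
    ∃ z, ∀ y, Tendsto (fun n => inner ℝ y (x n)) U (𝓝 (inner ℝ y z)) := by
  have hlim : ∀ y, ∃ a : ℝ, Tendsto (fun n => inner ℝ y (x n)) U (𝓝 a) := by
    intro y
    have hK : IsCompact (Set.Icc (-(‖y‖ * C)) (‖y‖ * C)) := isCompact_Icc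
    have := hK.ultrafilter_le_nhds (U.map fun n => inner ℝ y (x n)) (by
      rw [le_principal_iff]
      show ∀ᶠ n in U, inner ℝ y (x n) ∈ Set.Icc (-(‖y‖ * C)) (‖y‖ * C)
      filter_upwards [hx] with n hn
      have h := (abs_real_inner_le_norm y (x n)).trans
        (mul_le_mul_of_nonneg_left hn (norm_nonneg y))
      exact abs_le.1 h)
    obtain ⟨a, -, ha⟩ := this
    exact ⟨a, ha⟩
  choose f hf using hlim
  let F : E →ₗ[ℝ] ℝ :=
    { toFun := f
      map_add' := fun a b => tendsto_nhds_unique (hf (a + b))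
        (by simpa [inner_add_left] using (hf a).add (hf b))
      map_smul' := fun r a => tendsto_nhds_unique (hf (r • a))
        (by simpa [inner_smul_left] using (hf a).const_mul r) }
  have hb : ∀ y, ‖F y‖ ≤ C * ‖y‖ := by
    intro y
    refine le_of_tendsto (hf y).norm ?_
    filter_upwards [hx] with n hn
    calc ‖inner ℝ y (x n)‖ ≤ ‖y‖ * ‖x n‖ := norm_inner_le_norm _ _
      _ ≤ C * ‖y‖ := by rw [mul_comm]; gcongr
  refine ⟨(InnerProductSpace.toDual ℝ E).symm (F.mkContinuous C hb), fun y => ?_⟩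
  have : inner ℝ y ((InnerProductSpace.toDual ℝ E).symm (F.mkContinuous C hb)) = f y := by
    rw [real_inner_comm, InnerProductSpace.toDual_symm_apply]; rfl
  rw [this]
  exact hf y

/-- Demiclosedness principle for nonexpansive maps. -/
theorem isFixedPt_of_weak_limit {ι : Type*} {l : Filter ι} [l.NeBot] {T : E → E}
    (hT : ∀ x y, ‖T x - T y‖ ≤ ‖x - y‖) {x : ι → E} {z : E} {C : ℝ}
    (hb : ∀ᶠ n in l, ‖x n‖ ≤ C)
    (hz : ∀ y, Tendsto (fun n => inner ℝ y (x n)) l (𝓝 (inner ℝ y z)))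
    (hr : Tendsto (fun n => ‖x n - T (x n)‖) l (𝓝 0)) : T z = z := by
  -- Expand `‖x n - T z‖ ^ 2` around `z` and compare it with the bound from nonexpansiveness; the
  -- terms `‖x n - z‖ ^ 2` cancel.
  have key : ∀ᶠ n in l, ‖z - T z‖ ^ 2 ≤ ‖x n - T (x n)‖ ^ 2
      + 2 * (C + ‖z‖) * ‖x n - T (x n)‖ - 2 * (inner ℝ (z - T z) (x n) - inner ℝ (z - T z) z) := by
    filter_upwards [hb] with n hn
    have h1 : ‖x n - T z‖ ≤ ‖x n - T (x n)‖ + ‖x n - z‖ :=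
      calc ‖x n - T z‖ = ‖(x n - T (x n)) + (T (x n) - T z)‖ := by congr 1; abel
        _ ≤ _ := (norm_add_le _ _).trans (by gcongr; exact hT _ _)
    have h2 : ‖x n - z‖ ≤ C + ‖z‖ := (norm_sub_le _ _).trans (by gcongr)
    have h3 : ‖x n - T z‖ ^ 2 = ‖x n - z‖ ^ 2
        + 2 * (inner ℝ (z - T z) (x n) - inner ℝ (z - T z) z) + ‖z - T z‖ ^ 2 := by
      rw [← inner_sub_right, real_inner_comm, ← norm_add_sq_real]
      congr 2; abel
    have h4 : ‖x n - T z‖ ^ 2 ≤ (‖x n - T (x n)‖ + ‖x n - z‖) ^ 2 := by gcongr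
    nlinarith [mul_le_mul_of_nonneg_right h2 (norm_nonneg (x n - T (x n)))]
  have hlim : Tendsto (fun n => ‖x n - T (x n)‖ ^ 2 + 2 * (C + ‖z‖) * ‖x n - T (x n)‖
      - 2 * (inner ℝ (z - T z) (x n) - inner ℝ (z - T z) z)) l (𝓝 0) := by
    have := ((hr.pow 2).add (hr.const_mul (2 * (C + ‖z‖)))).sub
      (((hz (z - T z)).sub_const (inner ℝ (z - T z) z)).const_mul 2)
    simpa using this
  have h0 : ‖z - T z‖ ^ 2 ≤ 0 := ge_of_tendsto hlim key
  have h1 : ‖z - T z‖ = 0 := pow_eq_zero_iff two_ne_zero |>.1 (le_antisymm h0 (sq_nonneg _))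
  exact (sub_eq_zero.1 (norm_eq_zero.1 h1)).symm

variable {c : ℝ} {T : E → E} {x : ℕ → E}

/-- The distance of the `k`-th iterate from the start is at least `k` times the infimal
displacement along the orbit. -/
theorem exists_tendsto_displacement (hT : IsAveragedWith c T) (hc : 0 < c)
    (hx : ∀ n, x (n + 1) = T (x n)) :
    ∃ d, 0 ≤ d ∧ Tendsto (fun n => ‖x n - T (x n)‖) atTop (𝓝 d) ∧
      ∀ k : ℕ, k * d ≤ ‖x 0 - x k‖ := by
  have hne := hT.norm_sub_le hc
  have hanti : Antitone fun n => ‖x n - T (x n)‖ := by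
    simpa only [← hx] using antitone_norm_sub hne hx 1
  have hbdd : BddBelow (Set.range fun n => ‖x n - T (x n)‖) :=
    ⟨0, by rintro _ ⟨n, rfl⟩; exact norm_nonneg _⟩
  have hlim := tendsto_atTop_ciInf hanti hbdd
  set d := ⨅ n, ‖x n - T (x n)‖
  have hd : 0 ≤ d := le_ciInf fun n => norm_nonneg _
  have hdle : ∀ n, d ≤ ‖x n - T (x n)‖ := fun n => ciInf_le hbdd n
  refine ⟨d, hd, hlim, fun k => ?_⟩
  set δ : ℕ → E := fun n => x n - T (x n) with hδ
  -- Averagedness at `x n` and `T (x n)` bounds `c * ‖δ (n + 1) - δ n‖ ^ 2` by the drop in `‖δ n‖ ^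
  -- 2`, which tends to zero.
  have hδ1 : Tendsto (fun n => ‖δ (n + 1) - δ n‖) atTop (𝓝 0) := by
    have hsq : Tendsto (fun n => c⁻¹ * (‖δ n‖ ^ 2 - ‖δ (n + 1)‖ ^ 2)) atTop (𝓝 0) := by
      have := ((hlim.pow 2).sub ((hlim.comp (tendsto_add_atTop_nat 1)).pow 2)).const_mul c⁻¹
      simpa using this
    have h2 : Tendsto (fun n => ‖δ (n + 1) - δ n‖ ^ 2) atTop (𝓝 0) := by
      refine squeeze_zero (fun n => sq_nonneg _) (fun n => ?_) hsq
      have h := hT (x n) (T (x n))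
      rw [inv_mul_eq_div, le_div_iff₀ hc]
      have e : ‖δ (n + 1) - δ n‖ = ‖(x n - T (x n)) - (T (x n) - T (T (x n)))‖ := by
        rw [norm_sub_rev]; simp only [hδ, hx]
      rw [e]
      simp only [hδ, hx]
      linarith
    have := h2.sqrt
    simpa using this
  have hδk : ∀ i, Tendsto (fun n => ‖δ (n + i) - δ n‖) atTop (𝓝 0) := by
    intro i
    induction i with
    | zero => simp
    | succ i ih =>
      refine squeeze_zero (fun n => norm_nonneg _) (fun n => ?_)
        (by simpa using (hδ1.comp (tendsto_add_atTop_nat i)).add ih)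
      calc ‖δ (n + (i + 1)) - δ n‖ = ‖(δ (n + i + 1) - δ (n + i)) + (δ (n + i) - δ n)‖ := by
            rw [← add_assoc]; congr 1; abel
        _ ≤ _ := norm_add_le _ _
  have hsum : ∀ i, Tendsto (fun n => ‖(x n - x (n + i)) - (i : ℝ) • δ n‖) atTop (𝓝 0) := by
    intro i
    induction i with
    | zero => simp
    | succ i ih =>
      refine squeeze_zero (fun n => norm_nonneg _) (fun n => ?_)
        (by simpa using ih.add (hδk i))
      have e : (x n - x (n + (i + 1))) - ((i + 1 : ℕ) : ℝ) • δ n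
          = ((x n - x (n + i)) - (i : ℝ) • δ n) + (δ (n + i) - δ n) := by
        rw [← add_assoc, hx (n + i)]
        simp only [hδ]
        push_cast
        module
      rw [e]
      exact norm_add_le _ _
  -- Late in the orbit `k` steps are nearly `k` copies of one displacement; nonexpansiveness carries
  -- the estimate back to time `0`.
  have hle : ∀ n, k * d - ‖(x n - x (n + k)) - (k : ℝ) • δ n‖ ≤ ‖x 0 - x k‖ := by
    intro n
    have h1 : ‖x n - x (n + k)‖ ≤ ‖x 0 - x k‖ := by
      simpa using antitone_norm_sub hne hx k (Nat.zero_le n)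
    have h2 : ‖(k : ℝ) • δ n‖ ≤ ‖x n - x (n + k)‖ + ‖(x n - x (n + k)) - (k : ℝ) • δ n‖ :=
      calc ‖(k : ℝ) • δ n‖ = ‖(x n - x (n + k)) - ((x n - x (n + k)) - (k : ℝ) • δ n)‖ := by
            congr 1; abel
        _ ≤ _ := _root_.norm_sub_le _ _
    have h3 : ‖(k : ℝ) • δ n‖ = k * ‖δ n‖ := by rw [norm_smul]; simp
    have h4 : (k : ℝ) * d ≤ k * ‖δ n‖ := by gcongr; exact hdle n
    linarith
  have := (hsum k).const_sub (k * d)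
  exact le_of_tendsto (by simpa using this) (Eventually.of_forall hle)

/-- If an averaged map has no fixed point, its orbits are norm-divergent. -/
theorem tendsto_norm_atTop_of_fixedPoints_eq_empty [CompleteSpace E] (hT : IsAveragedWith c T)
    (hc : 0 < c) (hx : ∀ n, x (n + 1) = T (x n)) (hF : ∀ z, T z ≠ z) :
    Tendsto (fun n => ‖x n‖) atTop atTop := by
  obtain ⟨d, hd, hlim, hk⟩ := exists_tendsto_displacement hT hc hx
  rcases hd.eq_or_lt with rfl | hd
  · by_contra hcon
    rw [tendsto_atTop] at hcon
    push Not at hcon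
    obtain ⟨C, hC⟩ := hcon
    have hfr : ∃ᶠ n in atTop, ‖x n‖ ≤ C := hC.mono fun n hn => hn.le
    have : (atTop ⊓ 𝓟 {n | ‖x n‖ ≤ C}).NeBot := frequently_mem_iff_neBot.1 hfr
    let U : Ultrafilter ℕ := Ultrafilter.of (atTop ⊓ 𝓟 {n | ‖x n‖ ≤ C})
    have hU : (U : Filter ℕ) ≤ atTop ⊓ 𝓟 {n | ‖x n‖ ≤ C} := Ultrafilter.of_le _
    have hb : ∀ᶠ n in U, ‖x n‖ ≤ C := le_principal_iff.1 (hU.trans inf_le_right)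
    obtain ⟨z, hz⟩ := exists_weak_limit U hb
    exact hF z (isFixedPt_of_weak_limit (hT.norm_sub_le hc) hb hz
      (hlim.mono_left (hU.trans inf_le_left)))
  · have h1 : Tendsto (fun k : ℕ => k * d - ‖x 0‖) atTop atTop :=
      tendsto_atTop_add_const_right _ _ (tendsto_natCast_atTop_atTop.atTop_mul_const hd)
    refine tendsto_atTop_mono (fun k => ?_) h1
    have := (hk k).trans (_root_.norm_sub_le _ _)
    linarith

/-- If an averaged map has a fixed point, its orbits converge weakly to fixed points. -/
theorem exists_weaklyConvergesTo_fixedPoint [CompleteSpace E] (hT : IsAveragedWith c T)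
    (hc : 0 < c) (hx : ∀ n, x (n + 1) = T (x n)) {p : E} (hp : T p = p) :
    ∃ z, T z = z ∧ WeaklyConvergesTo x z := by
  have hne := hT.norm_sub_le hc
  have hconv : ∀ q, T q = q → ∃ r, Tendsto (fun n => ‖x n - q‖) atTop (𝓝 r) := by
    intro q hq
    refine ⟨_, tendsto_atTop_ciInf (antitone_nat_of_succ_le fun n => ?_)
      ⟨0, by rintro _ ⟨n, rfl⟩; exact norm_nonneg _⟩⟩
    have := hne (x n) q
    rwa [hq, ← hx] at this
  have hb : ∀ n, ‖x n‖ ≤ ‖x 0 - p‖ + ‖p‖ := by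
    intro n
    have hd : ‖x n - p‖ ≤ ‖x 0 - p‖ := by
      induction n with
      | zero => exact le_rfl
      | succ n ih =>
        have := hne (x n) p
        rw [hp, ← hx] at this
        exact this.trans ih
    calc ‖x n‖ = ‖(x n - p) + p‖ := by simp
      _ ≤ _ := (norm_add_le _ _).trans (by gcongr)
  obtain ⟨d, hd, hlim, hk⟩ := exists_tendsto_displacement hT hc hx
  have hd0 : d = 0 := by
    by_contra hne0
    have hpos : 0 < d := lt_of_le_of_ne hd (Ne.symm hne0)
    obtain ⟨k, hkk⟩ := exists_nat_gt ((‖x 0‖ + (‖x 0 - p‖ + ‖p‖)) / d)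
    rw [div_lt_iff₀ hpos] at hkk
    linarith [hk k, _root_.norm_sub_le (x 0) (x k), hb k]
  subst hd0
  have hcl : ∀ U : Ultrafilter ℕ, (U : Filter ℕ) ≤ atTop →
      ∃ z, T z = z ∧ ∀ y, Tendsto (fun n => inner ℝ y (x n)) U (𝓝 (inner ℝ y z)) := by
    intro U hU
    have hbU : ∀ᶠ n in U, ‖x n‖ ≤ ‖x 0 - p‖ + ‖p‖ := Eventually.of_forall hb
    obtain ⟨z, hz⟩ := exists_weak_limit U hbU
    exact ⟨z, isFixedPt_of_weak_limit hne hbU hz (hlim.mono_left hU), hz⟩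
  obtain ⟨z, hzT, hz⟩ := hcl (Ultrafilter.of atTop) (Ultrafilter.of_le _)
  refine ⟨z, hzT, weaklyConvergesTo_of_inner fun y => ?_⟩
  rw [tendsto_iff_ultrafilter]
  intro U hU
  obtain ⟨w, hwT, hw⟩ := hcl U hU
  suffices w = z by rw [← this]; exact hw y
  obtain ⟨r, hr⟩ := hconv z hzT
  obtain ⟨s, hs⟩ := hconv w hwT
  -- Opial's argument: distances to the fixed points `z` and `w` both converge, so this inner
  -- product has one limit along the whole sequence, hence the same along both ultrafilters.
  have hin : Tendsto (fun n => inner ℝ (z - w) (x n)) atTop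
      (𝓝 ((s ^ 2 - r ^ 2 + ‖z‖ ^ 2 - ‖w‖ ^ 2) / 2)) := by
    have := ((((hs.pow 2).sub (hr.pow 2)).add_const (‖z‖ ^ 2)).sub_const (‖w‖ ^ 2)).div_const 2
    refine this.congr fun n => ?_
    rw [norm_sub_sq_real, norm_sub_sq_real, inner_sub_left, real_inner_comm z,
      real_inner_comm w]
    ring
  have e1 := tendsto_nhds_unique (hz (z - w)) (hin.mono_left (Ultrafilter.of_le _))
  have e2 := tendsto_nhds_unique (hw (z - w)) (hin.mono_left hU)
  have : inner ℝ (z - w) (z - w) = 0 := by rw [inner_sub_right, e1, e2, sub_self]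
  exact (sub_eq_zero.1 (inner_self_eq_zero.1 this)).symm

end Averaged

/-! ### Minty's theorem and resolvents -/

section Minty

variable {X : Type*} [NormedAddCommGroup X] [InnerProductSpace ℝ X]

/-- A point monotonically related to the graph of a maximally monotone operator lies in it. -/
theorem IsMaximallyMonotone.mem_of_forall {A : X → Set X} (hA : IsMaximallyMonotone A) {x u : X}
    (h : ∀ y v, v ∈ A y → 0 ≤ inner ℝ (x - y) (u - v)) : u ∈ A x := by
  by_contra hu
  refine hA.2 (fun y => A y ∪ {v | y = x ∧ v = u}) (fun y => Set.subset_union_left) ?_ ?_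
  · intro e
    rw [congrFun e x] at hu
    exact hu (Or.inr ⟨rfl, rfl⟩)
  · rintro y v z w (hv | ⟨rfl, rfl⟩) (hw | ⟨rfl, rfl⟩)
    · exact hA.1 y v z w hv hw
    · have := h y v hv
      rwa [← neg_sub, ← neg_sub v, inner_neg_neg] at this
    · exact h z w hw
    · simp

/-- A function `t + ‖(x, u)‖² / 2` that is bounded below on a closed convex set attains its
minimum there. -/
theorem exists_isMinOn_add_norm_sq [CompleteSpace X] {S : Set (X × X × ℝ)} (hne : S.Nonempty)
    (hcl : IsClosed S) (hconv : Convex ℝ S)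
    (hbd : ∀ p ∈ S, 0 ≤ p.2.2 + ‖p.1‖ ^ 2 / 2 + ‖p.2.1‖ ^ 2 / 2) :
    ∃ p ∈ S, ∀ q ∈ S, p.2.2 + ‖p.1‖ ^ 2 / 2 + ‖p.2.1‖ ^ 2 / 2
      ≤ q.2.2 + ‖q.1‖ ^ 2 / 2 + ‖q.2.1‖ ^ 2 / 2 := by
  set Φ : X × X × ℝ → ℝ := fun p => p.2.2 + ‖p.1‖ ^ 2 / 2 + ‖p.2.1‖ ^ 2 / 2 with hΦ
  have hbb : BddBelow (Φ '' S) := ⟨0, by rintro _ ⟨p, hp, rfl⟩; exact hbd p hp⟩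
  set c := sInf (Φ '' S)
  have hc : ∀ p ∈ S, c ≤ Φ p := fun p hp => csInf_le hbb ⟨p, hp, rfl⟩
  have hex : ∀ n : ℕ, ∃ p ∈ S, Φ p < c + 1 / (n + 1 : ℝ) := by
    intro n
    obtain ⟨_, ⟨p, hp, rfl⟩, h⟩ := exists_lt_of_csInf_lt (hne.image Φ)
      (show c < c + 1 / (n + 1 : ℝ) by linarith [Nat.one_div_pos_of_nat (α := ℝ) (n := n)])
    exact ⟨p, hp, h⟩
  choose p hpS hpc using hex
  have hpar : ∀ v w : X, ‖(1 / 2 : ℝ) • v + (1 / 2 : ℝ) • w‖ ^ 2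
      = ‖v‖ ^ 2 / 2 + ‖w‖ ^ 2 / 2 - ‖v - w‖ ^ 2 / 4 := by
    intro v w
    rw [norm_add_sq_real, norm_sub_sq_real, norm_smul, norm_smul, inner_smul_left,
      inner_smul_right]
    norm_num
    ring
  -- The midpoint of two near-minimizers lies in `S`, so the parallelogram law bounds their
  -- distance.
  have hdist : ∀ i j, ‖(p i).1 - (p j).1‖ ^ 2 / 8 + ‖(p i).2.1 - (p j).2.1‖ ^ 2 / 8
      ≤ (1 / (i + 1 : ℝ) + 1 / (j + 1 : ℝ)) / 2 := by
    intro i j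
    have hm : (1 / 2 : ℝ) • p i + (1 / 2 : ℝ) • p j ∈ S :=
      hconv (hpS i) (hpS j) (by norm_num) (by norm_num) (by norm_num)
    have h := hc _ hm
    simp only [hΦ, Prod.fst_add, Prod.snd_add, Prod.smul_fst, Prod.smul_snd, hpar,
      smul_eq_mul] at h
    have h1 := hpc i
    have h2 := hpc j
    simp only [hΦ] at h1 h2
    linarith
  have hcau : ∀ f : ℕ → X, (∀ i j, ‖f i - f j‖ ^ 2 / 8 ≤ (1 / (i + 1 : ℝ) + 1 / (j + 1 : ℝ)) / 2) →
      CauchySeq f := by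
    intro f hf
    rw [Metric.cauchySeq_iff']
    intro ε hε
    obtain ⟨N, hN⟩ := exists_nat_one_div_lt (show 0 < ε ^ 2 / 8 by positivity)
    refine ⟨N, fun n hn => ?_⟩
    have h1 : 1 / (n + 1 : ℝ) ≤ 1 / (N + 1 : ℝ) := Nat.one_div_le_one_div hn
    have h2 := hf n N
    rw [dist_eq_norm]
    refine lt_of_pow_lt_pow_left₀ 2 hε.le ?_
    linarith
  obtain ⟨a, ha⟩ := cauchySeq_tendsto_of_complete (hcau (fun n => (p n).1) fun i j => by
    have := hdist i j; nlinarith [sq_nonneg ‖(p i).2.1 - (p j).2.1‖])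
  obtain ⟨b, hb⟩ := cauchySeq_tendsto_of_complete (hcau (fun n => (p n).2.1) fun i j => by
    have := hdist i j; nlinarith [sq_nonneg ‖(p i).1 - (p j).1‖])
  have hΦlim : Tendsto (fun n => Φ (p n)) atTop (𝓝 c) := by
    refine tendsto_of_tendsto_of_tendsto_of_le_of_le tendsto_const_nhds
      (by simpa using tendsto_one_div_add_atTop_nhds_zero_nat.const_add c)
      (fun n => hc _ (hpS n)) (fun n => (hpc n).le)
  have ht : Tendsto (fun n => (p n).2.2) atTop (𝓝 (c - ‖a‖ ^ 2 / 2 - ‖b‖ ^ 2 / 2)) := by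
    refine ((hΦlim.sub ((ha.norm.pow 2).div_const 2)).sub ((hb.norm.pow 2).div_const 2)).congr
      fun n => ?_
    simp only [hΦ]
    ring
  refine ⟨(a, b, c - ‖a‖ ^ 2 / 2 - ‖b‖ ^ 2 / 2),
    hcl.mem_of_tendsto (ha.prodMk_nhds (hb.prodMk_nhds ht)) (Eventually.of_forall hpS),
    fun q hq => ?_⟩
  have := hc q hq
  simp only [hΦ] at this
  dsimp only
  linarith

/-- The core of Minty's theorem: a monotone graph containing every point monotonically related to
it contains a point of the form `(p, -p)`. -/
theorem exists_graph_neg [CompleteSpace X] {G : X → X → Prop}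
    (hmono : ∀ x u y v, G x u → G y v → 0 ≤ inner ℝ (x - y) (u - v))
    (hmax : ∀ x u, (∀ y v, G y v → 0 ≤ inner ℝ (x - y) (u - v)) → G x u) :
    ∃ p, G p (-p) := by
  have hne : ∃ y v, G y v := by
    by_contra h
    push Not at h
    exact h 0 0 (hmax 0 0 fun y v hv => (h y v hv).elim)
  -- the epigraph of the Fitzpatrick function
  let S : Set (X × X × ℝ) :=
    {q | ∀ y v, G y v → inner ℝ q.1 v + inner ℝ y q.2.1 - inner ℝ y v ≤ q.2.2}
  have hgr : ∀ y v, G y v → (y, v, inner ℝ y v) ∈ S := by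
    intro y v hyv z w hzw
    have := hmono y v z w hyv hzw
    simp only [inner_sub_left, inner_sub_right] at this
    dsimp only
    linarith
  -- If this failed, `(x, u)` would be monotonically related to the graph, hence in it, and testing
  -- `q` against `(x, u)` itself gives a contradiction.
  have hF : ∀ q ∈ S, inner ℝ q.1 q.2.1 ≤ q.2.2 := by
    rintro ⟨x, u, t⟩ hq
    by_contra hlt
    dsimp only at hlt
    have hlt := not_le.1 hlt
    have hxu : G x u := hmax x u fun y v hyv => by
      have := hq y v hyv
      simp only [inner_sub_left, inner_sub_right]
      dsimp only at this
      linarith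
    have := hq x u hxu
    dsimp only at this
    linarith
  have hsq : ∀ a b : X, ‖a + b‖ ^ 2 = ‖a‖ ^ 2 + 2 * inner ℝ a b + ‖b‖ ^ 2 :=
    fun a b => norm_add_sq_real a b
  have hSne : S.Nonempty := by
    obtain ⟨y, v, h⟩ := hne
    exact ⟨_, hgr y v h⟩
  have hScl : IsClosed S := by
    simp only [S, Set.ofPred_forall]
    refine isClosed_iInter fun y => isClosed_iInter fun v => isClosed_iInter fun _ => ?_
    exact isClosed_le (by fun_prop) (by fun_prop)
  have hSconv : Convex ℝ S := by
    intro p hp q hq a b ha hb hab y v hyv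
    have h1 := mul_le_mul_of_nonneg_left (hp y v hyv) ha
    have h2 := mul_le_mul_of_nonneg_left (hq y v hyv) hb
    simp only [Prod.fst_add, Prod.snd_add, Prod.smul_fst, Prod.smul_snd, inner_add_left,
      inner_add_right, real_inner_smul_left, real_inner_smul_right, smul_eq_mul]
    have e : inner ℝ y v = a * inner ℝ y v + b * inner ℝ y v := by rw [← add_mul, hab, one_mul]
    rw [e]
    linarith
  obtain ⟨⟨x, u, t⟩, hpS, hmin⟩ := exists_isMinOn_add_norm_sq hSne hScl hSconv (fun p hp => by
    have h1 := hF p hp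
    have h2 := hsq p.1 p.2.1
    nlinarith [sq_nonneg ‖p.1 + p.2.1‖])
  have hxut := hF _ hpS
  dsimp only at hxut hmin
  -- first-order optimality in the direction of a graph point
  have hopt : ∀ y v, G y v →
      t + ‖x‖ ^ 2 + ‖u‖ ^ 2 ≤ inner ℝ y v + inner ℝ x y + inner ℝ u v := by
    intro y v hyv
    -- `D` is the derivative at `s = 0` of the objective along the segment from the minimizer to the
    -- graph point; `K` is the quadratic coefficient.
    set D := inner ℝ y v - t + (inner ℝ x y - ‖x‖ ^ 2) + (inner ℝ u v - ‖u‖ ^ 2) with hD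
    set K := ‖y - x‖ ^ 2 / 2 + ‖v - u‖ ^ 2 / 2 with hK
    have hexp : ∀ s : ℝ, 0 < s → s < 1 → 0 ≤ D + s * K := by
      intro s h0 h1
      have hmem := hSconv hpS (hgr y v hyv) (by linarith : 0 ≤ 1 - s) h0.le (by ring)
      have h := hmin _ hmem
      simp only [Prod.fst_add, Prod.snd_add, Prod.smul_fst, Prod.smul_snd, smul_eq_mul] at h
      have e : ∀ a b : X, ‖(1 - s) • a + s • b‖ ^ 2
          = ‖a‖ ^ 2 + 2 * s * (inner ℝ a b - ‖a‖ ^ 2) + s ^ 2 * ‖b - a‖ ^ 2 := by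
        intro a b
        have : (1 - s) • a + s • b = a + s • (b - a) := by module
        rw [this, hsq, norm_smul, inner_smul_right, inner_sub_right, real_inner_self_eq_norm_sq,
          mul_pow, Real.norm_eq_abs, sq_abs]
        ring
      rw [e, e] at h
      have : 0 ≤ s * (D + s * K) := by rw [hD, hK]; linarith
      exact nonneg_of_mul_nonneg_right this h0
    have hlim : Tendsto (fun s : ℝ => D + s * K) (𝓝[>] 0) (𝓝 D) := by
      have : Tendsto (fun s : ℝ => D + s * K) (𝓝 0) (𝓝 (D + 0 * K)) :=
        Continuous.tendsto (by fun_prop) 0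
      simpa using this.mono_left nhdsWithin_le_nhds
    have : 0 ≤ D := ge_of_tendsto hlim (by
      filter_upwards [Ioo_mem_nhdsGT (zero_lt_one' ℝ)] with s hs
      exact hexp s hs.1 hs.2)
    linarith
  -- The surplus `‖x + u‖ ^ 2` matters: once `(-u, -x)` is in the graph, testing it against itself
  -- forces `x = -u`.
  have hrel : ∀ y v, G y v → ‖x + u‖ ^ 2 ≤ inner ℝ (-u - y) (-x - v) := by
    intro y v hyv
    have h := hopt y v hyv
    rw [hsq]
    simp only [inner_sub_left, inner_sub_right, inner_neg_left, inner_neg_right]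
    rw [real_inner_comm x u, real_inner_comm x y] at *
    linarith
  have hmem : G (-u) (-x) := hmax _ _ fun y v hyv => (sq_nonneg _).trans (hrel y v hyv)
  have h0 := hrel _ _ hmem
  simp only [sub_self, inner_zero_left] at h0
  have h1 : ‖x + u‖ = 0 := pow_eq_zero_iff two_ne_zero |>.1 (le_antisymm h0 (sq_nonneg _))
  have h2 : x = -u := eq_neg_of_add_eq_zero_left (norm_eq_zero.1 h1)
  exact ⟨-u, by rwa [h2] at hmem⟩

/-- **Minty's theorem**: the resolvent of a maximally monotone operator on a Hilbert space is
everywhere defined. -/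
theorem IsMaximallyMonotone.setResolvent_nonempty [CompleteSpace X] {A : X → Set X}
    (hA : IsMaximallyMonotone A) (w : X) : (setResolvent A w).Nonempty := by
  -- Shifting the graph down by `w` turns `-p` into `w - p ∈ A p`.
  obtain ⟨p, hp⟩ := exists_graph_neg (G := fun y v => v + w ∈ A y)
    (fun x u y v hu hv => by simpa using hA.1 x _ y _ hu hv)
    (fun x u h => hA.mem_of_forall fun y v hv => by
      have := h y (v - w) (by simpa using hv)
      rwa [sub_sub_eq_add_sub] at this)
  exact ⟨p, mem_setResolvent.2 (by rwa [neg_add_eq_sub] at hp)⟩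

theorem IsMaximallyMonotone.resolventMap_eq_iff [CompleteSpace X] {A : X → Set X}
    (hA : IsMaximallyMonotone A) {x p : X} : p = resolventMap A x ↔ x - p ∈ A p := by
  have hne := hA.setResolvent_nonempty x
  have hmem : resolventMap A x ∈ setResolvent A x := by
    rw [resolventMap, dif_pos hne]
    exact hne.some_mem
  rw [← mem_setResolvent]
  exact ⟨fun h => h ▸ hmem, fun h => setResolvent_subsingleton hA.1 x h hmem⟩

/-- The resolvent of a maximally monotone operator is firmly nonexpansive. -/
theorem IsMaximallyMonotone.resolventMap_firmly_nonexpansive [CompleteSpace X] {A : X → Set X}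
    (hA : IsMaximallyMonotone A) (x y : X) :
    ‖resolventMap A x - resolventMap A y‖ ^ 2
      + ‖(x - y) - (resolventMap A x - resolventMap A y)‖ ^ 2 ≤ ‖x - y‖ ^ 2 := by
  have h := hA.1 _ _ _ _ (hA.resolventMap_eq_iff.1 (rfl : resolventMap A x = _))
    (hA.resolventMap_eq_iff.1 (rfl : resolventMap A y = _))
  rw [sub_sub_sub_comm, inner_sub_right, real_inner_self_eq_norm_sq] at h
  rw [norm_sub_sq_real (x - y), real_inner_comm]
  linarith

theorem IsMaximallyMonotone.smul {A : X → Set X} (hA : IsMaximallyMonotone A) {c : ℝ}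
    (hc : 0 < c) : IsMaximallyMonotone fun x => c • A x := by
  have hm : ∀ {x u}, u ∈ c • A x ↔ c⁻¹ • u ∈ A x := Set.mem_smul_set_iff_inv_smul_mem₀ hc.ne' _ _
  have hmono : IsMonotone fun x => c • A x := by
    intro x u y v hu hv
    have := hA.1 x _ y _ (hm.1 hu) (hm.1 hv)
    rw [← smul_sub, real_inner_smul_right] at this
    exact nonneg_of_mul_nonneg_right this (inv_pos.2 hc)
  refine ⟨hmono, fun B hB hne hBm => hne (funext fun x => (hB x).antisymm fun u hu => hm.2 ?_)⟩
  refine hA.mem_of_forall fun y v hv => ?_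
  have := hBm x u y (c • v) hu (hB y (Set.smul_mem_smul_set hv))
  have e : c⁻¹ • u - v = c⁻¹ • (u - c • v) := by rw [smul_sub, inv_smul_smul₀ hc.ne']
  rw [e, real_inner_smul_right]
  exact mul_nonneg (inv_pos.2 hc).le this

end Minty

/-! ### The product space and the map `opJ ∘ opR` -/

section Product

variable {X : Type*} [NormedAddCommGroup X] [InnerProductSpace ℝ X] {m : ℕ}

/-- The two inversions cancel, so the outer resolvent is a singleton for arbitrary `A i`. -/
theorem resolventMap_resolventAverage (lam : Fin m → ℝ) (A : Fin m → X → Set X) (x : X) :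
    resolventMap (resolventAverage lam A) x = ∑ i, lam i • resolventMap (A i) x := by
  have h : setResolvent (resolventAverage lam A) x = {∑ i, lam i • resolventMap (A i) x} := by
    ext p
    rw [mem_setResolvent]
    simp [resolventAverage, inverse]
  have hne : (setResolvent (resolventAverage lam A) x).Nonempty := by simp [h]
  rw [resolventMap, dif_pos hne]
  exact h.subset hne.some_mem

/-- The mean of the other components, in terms of the sum of all components. -/
theorem sum_erase_smul_eq {lam : Fin m → ℝ} (hm : 3 ≤ m) (hlam : ∀ i, lam i = 1 / (m : ℝ))
    (x : Fin m → X) (i : Fin m) :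
    ∑ j ∈ Finset.univ.erase i, (lam j / (1 - lam i)) • x j
      = ((m : ℝ) - 1)⁻¹ • (∑ j, x j - x i) := by
  have h3 : (3 : ℝ) ≤ m := by exact_mod_cast hm
  have h0 : (m : ℝ) ≠ 0 := by linarith
  have h1 : (m : ℝ) - 1 ≠ 0 := by linarith
  have hc : ∀ j, lam j / (1 - lam i) = ((m : ℝ) - 1)⁻¹ := by
    intro j
    rw [hlam, hlam]
    field_simp
  simp only [hc]
  rw [← Finset.smul_sum, Finset.sum_erase_eq_sub (Finset.mem_univ i)]

theorem sum_norm_smul_sub_smul_sq (x : Fin m → X) (D : X) (hD : D = ∑ i, x i) (a b : ℝ) :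
    ∑ i, ‖a • D - b • x i‖ ^ 2
      = (m * a ^ 2 - 2 * a * b) * ‖D‖ ^ 2 + b ^ 2 * ∑ i, ‖x i‖ ^ 2 := by
  have h : ∀ i, ‖a • D - b • x i‖ ^ 2
      = a ^ 2 * ‖D‖ ^ 2 - 2 * a * b * inner ℝ D (x i) + b ^ 2 * ‖x i‖ ^ 2 := by
    intro i
    rw [norm_sub_sq_real, norm_smul, norm_smul, real_inner_smul_left, real_inner_smul_right,
      mul_pow, mul_pow, Real.norm_eq_abs, Real.norm_eq_abs, sq_abs, sq_abs]
    ring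
  simp only [h, Finset.sum_add_distrib, Finset.sum_sub_distrib, ← Finset.mul_sum, ← inner_sum,
    ← hD, real_inner_self_eq_norm_sq]
  simp
  ring

/-- `opR` fixes the diagonal and multiplies its orthogonal complement by `-1 / (m - 1)`, so it
satisfies the averagedness inequality with equality for `κ = (m - 2) / m`. Composing with the firmly
nonexpansive `opJ` costs a factor `2`, since `κ ≤ 1`. -/
theorem isAveragedWith_opJ_comp_opR [CompleteSpace X] (hm : 3 ≤ m) {A : Fin m → X → Set X}
    (hA : ∀ i, IsMaximallyMonotone (A i)) {lam : Fin m → ℝ} (hlam : ∀ i, lam i = 1 / (m : ℝ)) :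
    IsAveragedWith (((m : ℝ) - 2) / m / 2) (opJ lam A ∘ opR lam) := by
  have h3 : (3 : ℝ) ≤ m := by exact_mod_cast hm
  have h0 : (m : ℝ) ≠ 0 := by linarith
  have h1 : (m : ℝ) - 1 ≠ 0 := by linarith
  intro x y
  set r := opR lam x - opR lam y with hr
  set e := (opJ lam A ∘ opR lam) x - (opJ lam A ∘ opR lam) y with he
  set d := x - y with hd
  have hri : ∀ i, r i = ((m : ℝ) - 1)⁻¹ • ∑ j, d j - ((m : ℝ) - 1)⁻¹ • d i := by
    intro i
    simp only [hr, opR, PiLp.sub_apply, sum_erase_smul_eq hm hlam, hd, Finset.sum_sub_distrib]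
    module
  have hfirm : ‖e‖ ^ 2 + ‖r - e‖ ^ 2 ≤ ‖r‖ ^ 2 := by
    simp only [PiLp.norm_sq_eq_of_L2, ← Finset.sum_add_distrib]
    refine Finset.sum_le_sum fun i _ => ?_
    have hpos : 0 < (1 - lam i)⁻¹ := by
      rw [hlam]
      refine inv_pos.2 (sub_pos.2 ?_)
      rw [div_lt_one (by linarith)]
      linarith
    exact ((hA i).smul hpos).resolventMap_firmly_nonexpansive (opR lam x i) (opR lam y i)
  have hR : ‖r‖ ^ 2 + ((m : ℝ) - 2) / m * ‖d - r‖ ^ 2 = ‖d‖ ^ 2 := by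
    have hdr : ∀ i, ‖(d - r) i‖
        = ‖((m : ℝ) - 1)⁻¹ • ∑ j, d j - ((m : ℝ) / (m - 1)) • d i‖ := by
      intro i
      rw [norm_sub_rev, PiLp.sub_apply, hri]
      congr 1
      have : (m : ℝ) / (m - 1) = 1 + ((m : ℝ) - 1)⁻¹ := by field_simp; ring
      rw [this]
      module
    simp only [PiLp.norm_sq_eq_of_L2]
    simp only [hdr, hri, sum_norm_smul_sub_smul_sq _ _ rfl]
    field_simp
    ring
  have hde : ‖d - e‖ ^ 2 ≤ 2 * (‖d - r‖ ^ 2 + ‖r - e‖ ^ 2) := by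
    have : ‖d - e‖ ≤ ‖d - r‖ + ‖r - e‖ := norm_sub_le_norm_sub_add_norm_sub _ _ _
    calc ‖d - e‖ ^ 2 ≤ (‖d - r‖ + ‖r - e‖) ^ 2 := by gcongr
      _ ≤ _ := by nlinarith [sq_nonneg (‖d - r‖ - ‖r - e‖)]
  have hk0 : 0 ≤ ((m : ℝ) - 2) / m := div_nonneg (by linarith) (by linarith)
  have hk1 : ((m : ℝ) - 2) / m ≤ 1 := (div_le_one (by linarith)).2 (by linarith)
  rw [sub_sub_sub_comm, ← hd, ← he]
  set κ := ((m : ℝ) - 2) / m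
  nlinarith [mul_le_mul_of_nonneg_left hde hk0, mul_le_mul_of_nonneg_right hk1 (sq_nonneg ‖r - e‖)]

theorem mem_setS_iff_isFixedPt {lam : Fin m → ℝ} {A : Fin m → X → Set X} {x : ProductSpace X m} :
    x ∈ setS lam A ↔ (opJ lam A ∘ opR lam) x = x := by
  constructor
  · intro h
    ext i
    exact (h i).symm
  · intro h i
    exact (congrArg (fun z : ProductSpace X m => z i) h).symm

theorem mem_setS_iff [CompleteSpace X] (hm : 3 ≤ m) {A : Fin m → X → Set X}
    (hA : ∀ i, IsMaximallyMonotone (A i)) {lam : Fin m → ℝ} (hlam : ∀ i, lam i = 1 / (m : ℝ))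
    {x : ProductSpace X m} :
    x ∈ setS lam A ↔ ∀ i, x i = resolventMap (A i) (∑ j, lam j • x j) := by
  have h3 : (3 : ℝ) ≤ m := by exact_mod_cast hm
  have h0 : (m : ℝ) ≠ 0 := by linarith
  have h1 : (m : ℝ) - 1 ≠ 0 := by linarith
  refine forall_congr' fun i => ?_
  have hpos : 0 < 1 - lam i := by
    rw [hlam]
    refine sub_pos.2 ?_
    rw [div_lt_one (by linarith)]
    linarith
  rw [scaledResolvent, ((hA i).smul (inv_pos.2 hpos)).resolventMap_eq_iff,
    (hA i).resolventMap_eq_iff, Set.mem_smul_set_iff_inv_smul_mem₀ (inv_pos.2 hpos).ne', inv_inv,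
    sum_erase_smul_eq hm hlam]
  -- The weights match because `(1 - 1 / m) / (m - 1) = 1 / m`.
  suffices (1 - lam i) • (((m : ℝ) - 1)⁻¹ • (∑ j, x j - x i) - x i)
      = ∑ j, lam j • x j - x i by rw [this]
  simp only [hlam, ← Finset.smul_sum]
  set D := ∑ j, x j
  match_scalars <;> field_simp
  ring

/-- Weak convergence in the product space passes to weighted sums of the components. -/
theorem WeaklyConvergesTo.sum_smul {x : ℕ → ProductSpace X m} {y : ProductSpace X m}
    (h : WeaklyConvergesTo x y) (lam : Fin m → ℝ) :
    WeaklyConvergesTo (fun n => ∑ i, lam i • x n i) (∑ i, lam i • y i) := by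
  let L : ProductSpace X m →L[ℝ] X :=
    ∑ i, lam i • PiLp.proj (𝕜 := ℝ) 2 (fun _ : Fin m => X) i
  have hL : ∀ z, L z = ∑ i, lam i • z i := fun z => by simp [L]
  simp only [← hL]
  exact ((WeakSpace.map L).continuous.tendsto _).comp h

end Product

end ResolventAverage

open ResolventAverage in
theorem theorem4p1 {X : Type*} [NormedAddCommGroup X] [InnerProductSpace ℝ X] [CompleteSpace X]
    (m : ℕ) (hm : 3 ≤ m)
    (A : Fin m → X → Set X) (hA : ∀ i, IsMaximallyMonotone (A i))
    (lam : Fin m → ℝ) (hlam : ∀ i, lam i = 1 / (m : ℝ))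
    (x : ℕ → ProductSpace X m) (hx : ∀ n, x (n + 1) = (opJ lam A ∘ opR lam) (x n)) :
    Xor
      ((Function.fixedPoints (resolventMap (resolventAverage lam A))).Nonempty ∧
        ∃ y ∈ setS lam A,
          WeaklyConvergesTo x y ∧
          WeaklyConvergesTo (fun n => ∑ i, lam i • x n i) (∑ i, lam i • y i) ∧
          ∑ i, lam i • y i ∈ Function.fixedPoints (resolventMap (resolventAverage lam A)))
      (Function.fixedPoints (resolventMap (resolventAverage lam A)) = ∅ ∧
        Tendsto (fun n => ‖x n‖) atTop atTop) := by
  have hfix : ∀ s, s ∈ Function.fixedPoints (resolventMap (resolventAverage lam A)) ↔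
      ∑ i, lam i • resolventMap (A i) s = s := fun s => by
    rw [← resolventMap_resolventAverage]; rfl
  have hS : ∀ y ∈ setS lam A,
      ∑ i, lam i • y i ∈ Function.fixedPoints (resolventMap (resolventAverage lam A)) := by
    intro y hy
    rw [mem_setS_iff hm hA hlam] at hy
    rw [hfix]
    exact Finset.sum_congr rfl fun i _ => by rw [← hy i]
  have hT := isAveragedWith_opJ_comp_opR hm hA hlam
  have hc : 0 < ((m : ℝ) - 2) / m / 2 := by
    have h3 : (3 : ℝ) ≤ m := by exact_mod_cast hm
    exact div_pos (div_pos (by linarith) (by linarith)) two_pos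
  rcases Set.eq_empty_or_nonempty
    (Function.fixedPoints (resolventMap (resolventAverage lam A))) with hE | hE
  · refine Or.inr ⟨⟨hE, tendsto_norm_atTop_of_fixedPoints_eq_empty hT hc hx fun z hz => ?_⟩,
      fun h => h.1.ne_empty hE⟩
    have := hS z (mem_setS_iff_isFixedPt.2 hz)
    rw [hE] at this
    exact this
  · refine Or.inl ⟨⟨hE, ?_⟩, fun h => hE.ne_empty h.1⟩
    obtain ⟨s, hs⟩ := hE
    rw [hfix] at hs
    -- The weighted mean of the points `J_{A i} s` is `s` again.
    have hp : WithLp.toLp 2 (fun i => resolventMap (A i) s) ∈ setS lam A := by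
      rw [mem_setS_iff hm hA hlam]
      intro i
      dsimp only
      rw [hs]
    obtain ⟨y, hy, hxy⟩ :=
      exists_weaklyConvergesTo_fixedPoint hT hc hx (mem_setS_iff_isFixedPt.1 hp)
    have hyS := mem_setS_iff_isFixedPt.2 hy
    exact ⟨y, hyS, hxy, hxy.sum_smul lam, hS y hyS⟩
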